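/- **Setting.** For points $X_1,\dots,X_N\in\mathbb R^d$ and $w\in\mathbb R^N$ let $\mu_w=\sum_i w_iX_i$, $\Sigma_w=\sum_i w_iX_iX_i^\top-\mu_w\mu_w^\top$ (which equals $\sum_i w_i(X_i-\mu_w)(X_i-\mu_w)^\top$ when $\sum_i w_i=1$) and $F(w,u)=u^\top\Sigma_wu$. Let $\|\cdot\|_2$ be the Euclidean norm of vectors and the spectral norm of matrices, and let $\Delta_{N,\varepsilon}=\{w\in\mathbb R^N:\|w\|_1=1,\ 0\le w_i\le \frac1{(1-\varepsilon)N}\ \forall i\}$. *Projected sub-gradient descent* on $\min_{w\in\Delta_{N,2\varepsilon}}\|\Sigma_w\|_2$ with step size $\eta>0$ and $T$ iterations starts from an arbitrary $w_0\in\Delta_{N,2\varepsilon}$. For $\tau=0,\dots,T-1$ it takes any unit vector $u_\tau$ with $F(w_\tau,u_\tau)\ge(1-\varepsilon)\max_{\|v\|_2=1}F(w_\tau,v)$ and lets $w_{\tau+1}$ be the Euclidean projection of $w_\tau-\eta\nabla_wF(w_\tau,u_\tau)$ onto $\Delta_{N,2\varepsilon}$. It outputs some $w_{\tau'}$, $0\le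 \tau'<T$, with $\|\Sigma_{w_{\tau'}}\|_2=\min_{0\le\tau<T}\|\Sigma_{w_\tau}\|_2$. **Theorem.** For all constants $c_1,c_2,c_3>0$ there are $\varepsilon_0\in(0,\frac12)$, $C,K>0$ and $k\in\mathbb N$ such that the following holds for all $d\ge1$, $0<\varepsilon<\varepsilon_0$ and $N\ge d/\varepsilon^2$. There is a step size $\eta>0$, depending only on $c_1,c_2,c_3,d,N,\varepsilon$, such that whenever $X_1,\dots,X_N\in\mathbb R^d$, $\mu^\star\in\mathbb R^d$ and $G\subseteq\{1,\dots,N\}$ (the remaining good samples) with $N-|G|\le\varepsilon N$ satisfy 1. $\bigl\|\sum_{i\in G}w_i(X_i-\mu^\star)(X_i-\mu^\star)^\top-I\bigr\|_2\le c_1\,\varepsilon\log(1/\varepsilon)$ for all $w\in\Delta_{N,2\varepsilon}$; 2. for all $w\in\Delta_{N,2\varepsilon}$ and $\delta\ge0$, if $\lambda_{\max}(\Sigma_w)\le1+\delta$ then $\|\mu^\star-\mu_w\|_2\le c_2\bigl(\sqrt{\varepsilon\delta}+\varepsilon\sqrt{\log(1/\varepsilon)}\bigr)$; 3. for some $a\in\mathbb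 R^d$, $\|X_i-a\|_2\le c_3\sqrt{d\log(Nd)}$ for all $i$; then for every integer $T\ge K\,N^2d^4\log^k(Nd)$, every run of $T$ iterations of projected sub-gradient descent with step size $\eta$ outputs a $w$ with $$\|\mu_w-\mu^\star\|_2\le C\,\varepsilon\sqrt{\log(1/\varepsilon)}.$$ No further assumption is made on how the points arise; in particular this applies to every $\varepsilon$-corrupted set of $N$ samples from the Gaussian $\mathcal N(\mu^\star,I)$ for which 1--3 hold. -/

import Mathlib

noncomputable section

/-- `Δ_{N,ε}`: weight vectors with `‖w‖₁ = 1` and `0 ≤ w_i ≤ 1 / ((1 - ε) N)`. -/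
def weightSet (N : ℕ) (ε : ℝ) : Set (EuclideanSpace ℝ (Fin N)) :=
  {w | ∑ i, |w i| = 1 ∧ ∀ i, 0 ≤ w i ∧ w i ≤ 1 / ((1 - ε) * N)}

/-- The spectral norm of a matrix (operator norm for the Euclidean norm). -/
def spectralNorm₂ {d : ℕ} (A : Matrix (Fin d) (Fin d) ℝ) : ℝ :=
  ‖Matrix.toEuclideanCLM (n := Fin d) (𝕜 := ℝ) A‖

/-- The rank-one matrix `x xᵀ`. -/
def outerSq {d : ℕ} (x : EuclideanSpace ℝ (Fin d)) : Matrix (Fin d) (Fin d) ℝ :=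
  Matrix.vecMulVec x.ofLp x.ofLp

/-- The weighted empirical mean `μ_w = X w = ∑ i, w_i X_i`. -/
def weightedMean {N d : ℕ} (X : Fin N → EuclideanSpace ℝ (Fin d))
    (w : EuclideanSpace ℝ (Fin N)) : EuclideanSpace ℝ (Fin d) :=
  ∑ i, w i • X i

/-- The weighted empirical covariance `Σ_w = X diag(w) Xᵀ - X w wᵀ Xᵀ`, as a function of all
`w ∈ ℝ^N`. For weights of total mass one it is the centred expression
`∑ i, w_i (X_i - μ_w) (X_i - μ_w)ᵀ`, see `weightedCov_eq_centred`. -/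
def weightedCov {N d : ℕ} (X : Fin N → EuclideanSpace ℝ (Fin d))
    (w : EuclideanSpace ℝ (Fin N)) : Matrix (Fin d) (Fin d) ℝ :=
  ∑ i, w i • outerSq (X i) - outerSq (weightedMean X w)

theorem weightedCov_eq_centred {N d : ℕ} (X : Fin N → EuclideanSpace ℝ (Fin d))
    (w : EuclideanSpace ℝ (Fin N)) (hw : ∑ i, w i = 1) :
    weightedCov X w = ∑ i, w i • outerSq (X i - weightedMean X w) := by
  ext a b
  have hm : ∀ c, (weightedMean X w) c = ∑ i, w i * X i c := by
    intro c
    simp [weightedMean]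
  simp only [weightedCov, outerSq, Matrix.sub_apply, Matrix.sum_apply, Matrix.smul_apply,
    Matrix.vecMulVec_apply, smul_eq_mul, WithLp.ofLp_sub, Pi.sub_apply]
  have h1 : ∀ i, w i * ((X i a - weightedMean X w a) * (X i b - weightedMean X w b))
      = w i * (X i a * X i b) - weightedMean X w b * (w i * X i a)
        - weightedMean X w a * (w i * X i b)
        + weightedMean X w a * weightedMean X w b * w i := by
    intro i
    ring
  rw [Finset.sum_congr rfl fun i _ => h1 i]
  simp only [Finset.sum_add_distrib, Finset.sum_sub_distrib, ← Finset.mul_sum, hw, ← hm]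
  ring

/-- `F(w, u) = uᵀ Σ_w u`. -/
def quadForm {N d : ℕ} (X : Fin N → EuclideanSpace ℝ (Fin d))
    (w : EuclideanSpace ℝ (Fin N)) (u : EuclideanSpace ℝ (Fin d)) : ℝ :=
  u.ofLp ⬝ᵥ (weightedCov X w).mulVec u.ofLp

/-- `p` is the Euclidean projection of `y` onto the set `K`. -/
def IsProjOnto {N : ℕ} (K : Set (EuclideanSpace ℝ (Fin N)))
    (y p : EuclideanSpace ℝ (Fin N)) : Prop :=
  p ∈ K ∧ ∀ q ∈ K, ‖y - p‖ ≤ ‖y - q‖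

/-- `w 0, …, w T` and `u 0, …, u (T-1)` are the iterates and the approximate top eigenvectors of
a run of `T` iterations of projected sub-gradient descent with step size `η` for minimizing
`‖Σ_w‖₂` over `Δ_{N,2ε}`: the start is arbitrary in `Δ_{N,2ε}`, each `u τ` is any unit vector
with `F(w_τ, u_τ) ≥ (1 - ε) max_v F(w_τ, v)`, the maximum being over unit vectors, and
`w_{τ+1}` is the projection of `w_τ - η ∇_w F(w_τ, u_τ)` onto `Δ_{N,2ε}`. -/
structure IsPGDRun {N d : ℕ} (X : Fin N → EuclideanSpace ℝ (Fin d)) (ε η : ℝ) (T : ℕ)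
    (w : ℕ → EuclideanSpace ℝ (Fin N)) (u : ℕ → EuclideanSpace ℝ (Fin d)) : Prop where
  init : w 0 ∈ weightSet N (2 * ε)
  unit : ∀ τ < T, ‖u τ‖ = 1
  approx_max : ∀ τ < T, ∀ v : EuclideanSpace ℝ (Fin d), ‖v‖ = 1 →
    (1 - ε) * quadForm X (w τ) v ≤ quadForm X (w τ) (u τ)
  step : ∀ τ < T, IsProjOnto (weightSet N (2 * ε))
    (w τ - η • gradient (fun x => quadForm X x (u τ)) (w τ)) (w (τ + 1))

/-- `x` is the output of the run: an iterate `w τ'`, `0 ≤ τ' < T`, of smallest objective value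
`‖Σ_w‖₂`. -/
def IsPGDOutput {N d : ℕ} (X : Fin N → EuclideanSpace ℝ (Fin d)) (T : ℕ)
    (w : ℕ → EuclideanSpace ℝ (Fin N)) (x : EuclideanSpace ℝ (Fin N)) : Prop :=
  ∃ τ' < T, x = w τ' ∧
    ∀ τ < T, spectralNorm₂ (weightedCov X (w τ')) ≤ spectralNorm₂ (weightedCov X (w τ))

/-- Concentration of the second moments of the remaining good samples, indexed by `G`, for all
weights on the corrupted sample: for all `w ∈ Δ_{N,2ε}`,
`‖∑_{i ∈ G} w_i (X_i - μ) (X_i - μ)ᵀ - I‖₂ ≤ c ε log(1/ε)`. -/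
def GoodMoments {N d : ℕ} (X : Fin N → EuclideanSpace ℝ (Fin d)) (G : Finset (Fin N))
    (μ : EuclideanSpace ℝ (Fin d)) (ε c : ℝ) : Prop :=
  ∀ w ∈ weightSet N (2 * ε),
    spectralNorm₂ (∑ i ∈ G, w i • outerSq (X i - μ) - 1) ≤ c * (ε * Real.log (1 / ε))

/-- A small weighted covariance certifies an accurate weighted mean: for all `w ∈ Δ_{N,2ε}` and
`δ ≥ 0`, if `λ_max(Σ_w) ≤ 1 + δ` then `‖μ - μ_w‖₂ ≤ c (√(ε δ) + ε √(log(1/ε)))`. For such `w` the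
matrix `Σ_w` is positive semidefinite, so `λ_max(Σ_w)` is its spectral norm. -/
def CovCertifiesMean {N d : ℕ} (X : Fin N → EuclideanSpace ℝ (Fin d))
    (μ : EuclideanSpace ℝ (Fin d)) (ε c : ℝ) : Prop :=
  ∀ w ∈ weightSet N (2 * ε), ∀ δ : ℝ, 0 ≤ δ → spectralNorm₂ (weightedCov X w) ≤ 1 + δ →
    ‖μ - weightedMean X w‖ ≤ c * (√(ε * δ) + ε * √(Real.log (1 / ε)))

end

/-!
The objective `‖Σ_w‖₂` is not convex in `w`, but relative to one fixed point its sub-gradients behave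
as if it were. For weights `w`, `v` of total mass one,
`⟨∇_w F(w, u), w - v⟩ = F(w, u) - ∑ i, v_i ⟨X_i - μ_w, u⟩²`
(`inner_centredGradient_sub`). Let `v` be the uniform weights on the good samples and let
`‖Σ_w‖₂ = 1 + δ`. If `u` is an approximate top eigenvector, the first term is at least
`(1 - ε)(1 + δ)`. The second is the second moment of the good samples about `μ_w` in direction `u`;
moving its centre from `μ_w` to `μ` changes it only by terms controlled by
`‖μ_w - μ‖ = O(√(ε δ) + ε √(log(1/ε)))`, and about `μ` it is at most `1 + O(ε log(1/ε))`. So as soon as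
`δ` exceeds a large multiple `δ₀` of `ε log(1/ε)`, the inner product is at least `δ₀ / 2`
(`half_le_inner_centredGradient`).

Hence, with a step size of order `δ₀ / H`, where `H` bounds the squared norm of the gradient, every
projected step taken above the threshold `1 + δ₀` decreases the squared distance to `v` by
`δ₀² / (4 H)`. That distance is at most `2`, so some iterate among the first `O(H / δ₀²)` lies below
the threshold (`IsPGDRun.exists_spectralNorm₂_le`). The gradient may be translated by a constant
vector, since all weights have total mass one; after centring it at `μ_w` its entries are
`O(d log(Nd))`, which gives `H = O(N d² log²(Nd))`, while `1 / δ₀² ≤ 1 / ε² ≤ N`. The output then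
satisfies `‖Σ_w‖₂ ≤ 1 + δ₀`, and the hypothesis `CovCertifiesMean` converts this into the bound on
the mean.
-/

open scoped RealInnerProductSpace

/-! ### Quadratic forms of weighted covariances -/

theorem dotProduct_outerSq_mulVec {d : ℕ} (x u : EuclideanSpace ℝ (Fin d)) :
    u.ofLp ⬝ᵥ (outerSq x).mulVec u.ofLp = ⟪x, u⟫ ^ 2 := by
  rw [outerSq, Matrix.vecMulVec_mulVec, EuclideanSpace.inner_eq_star_dotProduct, star_trivial,
    op_smul_eq_smul, dotProduct_smul, smul_eq_mul, dotProduct_comm x.ofLp, sq]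

theorem dotProduct_sum_smul_outerSq_mulVec {N d : ℕ} (s : Finset (Fin N)) (a : Fin N → ℝ)
    (Y : Fin N → EuclideanSpace ℝ (Fin d)) (u : EuclideanSpace ℝ (Fin d)) :
    u.ofLp ⬝ᵥ (∑ i ∈ s, a i • outerSq (Y i)).mulVec u.ofLp = ∑ i ∈ s, a i * ⟪Y i, u⟫ ^ 2 := by
  simp only [Matrix.sum_mulVec, dotProduct_sum, Matrix.smul_mulVec, dotProduct_smul,
    dotProduct_outerSq_mulVec, smul_eq_mul]

theorem inner_weightedMean {N d : ℕ} (X : Fin N → EuclideanSpace ℝ (Fin d))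
    (w : EuclideanSpace ℝ (Fin N)) (u : EuclideanSpace ℝ (Fin d)) :
    ⟪weightedMean X w, u⟫ = ∑ i, w i * ⟪X i, u⟫ := by
  simp only [weightedMean, sum_inner, real_inner_smul_left]

theorem quadForm_eq {N d : ℕ} (X : Fin N → EuclideanSpace ℝ (Fin d))
    (w : EuclideanSpace ℝ (Fin N)) (u : EuclideanSpace ℝ (Fin d)) :
    quadForm X w u = ∑ i, w i * ⟪X i, u⟫ ^ 2 - ⟪weightedMean X w, u⟫ ^ 2 := by
  rw [quadForm, weightedCov, Matrix.sub_mulVec, dotProduct_sub,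
    dotProduct_sum_smul_outerSq_mulVec, dotProduct_outerSq_mulVec]

/-- Bias-variance decomposition of the second moment in direction `u` about a point `m`. -/
theorem sum_mul_inner_sub_sq {N d : ℕ} (X : Fin N → EuclideanSpace ℝ (Fin d))
    {w : EuclideanSpace ℝ (Fin N)} (hw : ∑ i, w i = 1) (m u : EuclideanSpace ℝ (Fin d)) :
    ∑ i, w i * ⟪X i - m, u⟫ ^ 2 = quadForm X w u + ⟪weightedMean X w - m, u⟫ ^ 2 := by
  have h : ∀ i, w i * ⟪X i - m, u⟫ ^ 2
      = w i * ⟪X i, u⟫ ^ 2 - 2 * ⟪m, u⟫ * (w i * ⟪X i, u⟫) + ⟪m, u⟫ ^ 2 * w i := by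
    intro i
    rw [inner_sub_left]
    ring
  rw [Finset.sum_congr rfl fun i _ => h i]
  simp only [Finset.sum_add_distrib, Finset.sum_sub_distrib, ← Finset.mul_sum, hw,
    ← inner_weightedMean, quadForm_eq]
  rw [inner_sub_left]
  ring

theorem quadForm_eq_sum_centred {N d : ℕ} (X : Fin N → EuclideanSpace ℝ (Fin d))
    {w : EuclideanSpace ℝ (Fin N)} (hw : ∑ i, w i = 1) (u : EuclideanSpace ℝ (Fin d)) :
    quadForm X w u = ∑ i, w i * ⟪X i - weightedMean X w, u⟫ ^ 2 := by
  simp [sum_mul_inner_sub_sq X hw]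

theorem quadForm_nonneg {N d : ℕ} (X : Fin N → EuclideanSpace ℝ (Fin d))
    {w : EuclideanSpace ℝ (Fin N)} (hw0 : ∀ i, 0 ≤ w i) (hw : ∑ i, w i = 1)
    (u : EuclideanSpace ℝ (Fin d)) : 0 ≤ quadForm X w u := by
  rw [quadForm_eq_sum_centred X hw]
  exact Finset.sum_nonneg fun i _ => mul_nonneg (hw0 i) (sq_nonneg _)

theorem isHermitian_weightedCov {N d : ℕ} (X : Fin N → EuclideanSpace ℝ (Fin d))
    (w : EuclideanSpace ℝ (Fin N)) : (weightedCov X w).IsHermitian := by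
  ext a b
  simp [weightedCov, outerSq, Matrix.sum_apply, Matrix.vecMulVec_apply, mul_comm]

theorem inner_toEuclideanCLM_weightedCov {N d : ℕ} (X : Fin N → EuclideanSpace ℝ (Fin d))
    (w : EuclideanSpace ℝ (Fin N)) (u : EuclideanSpace ℝ (Fin d)) :
    ⟪Matrix.toEuclideanCLM (n := Fin d) (𝕜 := ℝ) (weightedCov X w) u, u⟫ = quadForm X w u := by
  rw [real_inner_comm, Matrix.inner_toEuclideanCLM, quadForm]

/-- `Σ_w` is positive semidefinite for probability weights, so its spectral norm is the maximum
of its quadratic form on the unit sphere. -/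
theorem spectralNorm₂_weightedCov_le {N d : ℕ} (X : Fin N → EuclideanSpace ℝ (Fin d))
    {w : EuclideanSpace ℝ (Fin N)} (hw0 : ∀ i, 0 ≤ w i) (hw : ∑ i, w i = 1) {c : ℝ} (hc : 0 ≤ c)
    (h : ∀ v : EuclideanSpace ℝ (Fin d), ‖v‖ = 1 → quadForm X w v ≤ c) :
    spectralNorm₂ (weightedCov X w) ≤ c := by
  set A := Matrix.toEuclideanCLM (n := Fin d) (𝕜 := ℝ) (weightedCov X w) with hA
  have hsymm : A.IsSymmetric :=
    Matrix.isSymmetric_toEuclideanLin_iff.2 (isHermitian_weightedCov X w)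
  rw [spectralNorm₂, ← hA, A.norm_eq_iSup_rayleighQuotient hsymm]
  refine ciSup_le fun x => ?_
  rcases eq_or_ne x 0 with rfl | hx
  · simpa using hc
  have hx' : ‖x‖ ≠ 0 := norm_ne_zero_iff.2 hx
  rw [← A.rayleigh_smul x (inv_ne_zero hx')]
  have hv : ‖‖x‖⁻¹ • x‖ = 1 := by
    rw [norm_smul, norm_inv, norm_norm, inv_mul_cancel₀ hx']
  have hq : A.rayleighQuotient (‖x‖⁻¹ • x) = quadForm X w (‖x‖⁻¹ • x) := by
    rw [ContinuousLinearMap.rayleighQuotient, hv, ContinuousLinearMap.reApplyInnerSelf_apply,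
      hA, inner_toEuclideanCLM_weightedCov]
    simp
  rw [hq, abs_of_nonneg (quadForm_nonneg X hw0 hw _)]
  exact h _ hv

theorem dotProduct_mulVec_le_spectralNorm₂ {d : ℕ} (A : Matrix (Fin d) (Fin d) ℝ)
    {u : EuclideanSpace ℝ (Fin d)} (hu : ‖u‖ = 1) :
    u.ofLp ⬝ᵥ A.mulVec u.ofLp ≤ spectralNorm₂ A := by
  rw [← Matrix.inner_toEuclideanCLM]
  refine (real_inner_le_norm _ _).trans ?_
  have := (Matrix.toEuclideanCLM (n := Fin d) (𝕜 := ℝ) A).le_opNorm u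
  simpa [hu, spectralNorm₂] using this

/-! ### The gradient in the weights -/

theorem gradient_quadForm {N d : ℕ} (X : Fin N → EuclideanSpace ℝ (Fin d))
    (w : EuclideanSpace ℝ (Fin N)) (u : EuclideanSpace ℝ (Fin d)) :
    gradient (fun x => quadForm X x u) w
      = WithLp.toLp 2 fun i => ⟪X i, u⟫ ^ 2 - 2 * ⟪weightedMean X w, u⟫ * ⟪X i, u⟫ := by
  set a : EuclideanSpace ℝ (Fin N) := WithLp.toLp 2 fun i => ⟪X i, u⟫ with ha
  set b : EuclideanSpace ℝ (Fin N) := WithLp.toLp 2 fun i => ⟪X i, u⟫ ^ 2 with hb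
  have hF : (fun x => quadForm X x u) = fun x => ⟪b, x⟫ - ⟪a, x⟫ ^ 2 := by
    funext x
    rw [quadForm_eq, inner_weightedMean]
    simp [ha, hb, PiLp.inner_apply]
  have haw : ⟪a, w⟫ = ⟪weightedMean X w, u⟫ := by
    rw [inner_weightedMean]
    simp [ha, PiLp.inner_apply]
  apply HasGradientAt.gradient
  rw [hasGradientAt_iff_hasFDerivAt, hF]
  have hfb := (innerSL ℝ b).hasFDerivAt (x := w)
  have hfa := (innerSL ℝ a).hasFDerivAt (x := w)
  refine (hfb.sub (hfa.pow 2)).congr_fderiv ?_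
  ext x
  have hv : (WithLp.toLp 2 fun i => ⟪X i, u⟫ ^ 2 - 2 * ⟪weightedMean X w, u⟫ * ⟪X i, u⟫)
      = b - (2 * ⟪weightedMean X w, u⟫) • a := by
    ext i
    simp [ha, hb]
  simp only [hv, sub_apply, smul_apply, innerSL_apply_apply, InnerProductSpace.toDual_apply_apply,
    haw, inner_sub_left, real_inner_smul_left]
  simp

/-! ### The capped simplex and projections onto it -/

theorem sum_eq_one_of_mem_weightSet {N : ℕ} {ε : ℝ} {w : EuclideanSpace ℝ (Fin N)}
    (hw : w ∈ weightSet N ε) : ∑ i, w i = 1 := by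
  rw [← hw.1]
  exact Finset.sum_congr rfl fun i _ => (abs_of_nonneg (hw.2 i).1).symm

theorem convex_weightSet (N : ℕ) (ε : ℝ) : Convex ℝ (weightSet N ε) := by
  intro x hx y hy a b ha hb hab
  have h0 : ∀ i, 0 ≤ (a • x + b • y) i := fun i => by
    have := mul_nonneg ha (hx.2 i).1
    have := mul_nonneg hb (hy.2 i).1
    simpa using by linarith
  refine ⟨?_, fun i => ⟨h0 i, ?_⟩⟩
  · rw [Finset.sum_congr rfl fun i _ => abs_of_nonneg (h0 i)]
    simp [Finset.sum_add_distrib, ← Finset.mul_sum, sum_eq_one_of_mem_weightSet hx,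
      sum_eq_one_of_mem_weightSet hy, hab]
  · have h1 := mul_le_mul_of_nonneg_left (hx.2 i).2 ha
    have h2 := mul_le_mul_of_nonneg_left (hy.2 i).2 hb
    have h3 : a * (1 / ((1 - ε) * N)) + b * (1 / ((1 - ε) * N)) = 1 / ((1 - ε) * N) := by
      rw [← add_mul, hab, one_mul]
    rw [← h3]
    exact add_le_add h1 h2

theorem norm_le_one_of_mem_weightSet {N : ℕ} {ε : ℝ} {w : EuclideanSpace ℝ (Fin N)}
    (hw : w ∈ weightSet N ε) : ‖w‖ ≤ 1 := by
  have h1 : ∀ i, w i ≤ 1 := fun i => by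
    rw [← sum_eq_one_of_mem_weightSet hw]
    exact Finset.single_le_sum (f := fun i => w i) (fun j _ => (hw.2 j).1) (Finset.mem_univ i)
  rw [← sq_le_one_iff₀ (norm_nonneg _), EuclideanSpace.real_norm_sq_eq,
    ← sum_eq_one_of_mem_weightSet hw]
  refine Finset.sum_le_sum fun i _ => ?_
  nlinarith [h1 i, (hw.2 i).1]

theorem IsProjOnto.inner_le_zero {N : ℕ} {K : Set (EuclideanSpace ℝ (Fin N))}
    (hK : Convex ℝ K) {y p q : EuclideanSpace ℝ (Fin N)} (hp : IsProjOnto K y p) (hq : q ∈ K) :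
    ⟪y - p, q - p⟫ ≤ 0 := by
  refine (norm_eq_iInf_iff_real_inner_le_zero hK hp.1).1 (le_antisymm ?_ ?_) q hq
  · have : Nonempty K := ⟨⟨p, hp.1⟩⟩
    exact le_ciInf fun q => hp.2 q q.2
  · exact ciInf_le (f := fun q : K => ‖y - q‖) ⟨0, by rintro _ ⟨q, rfl⟩; positivity⟩ ⟨p, hp.1⟩

/-- Projecting onto the capped simplex does not see translations of the argument along the all-ones
vector, so a projected step along `g` is no farther from a point `q` of the simplex than the
unprojected step along any `h` that differs from `g` by a constant vector. -/
theorem IsProjOnto.norm_sub_sq_le {N : ℕ} {ε η c : ℝ} {w g h p q : EuclideanSpace ℝ (Fin N)}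
    (hp : IsProjOnto (weightSet N ε) (w - η • g) p) (hq : q ∈ weightSet N ε)
    (hgh : ∀ i, h i = g i + c) :
    ‖p - q‖ ^ 2 ≤ ‖w - q‖ ^ 2 - 2 * η * ⟪h, w - q⟫ + η ^ 2 * ‖h‖ ^ 2 := by
  have hangle := hp.inner_le_zero (convex_weightSet N ε) hq
  have hshift : ⟪h - g, q - p⟫ = 0 := by
    have : ∀ i, ⟪(h - g) i, (q - p) i⟫ = c * q i - c * p i := fun i => by
      simp [hgh i]
      ring
    simp only [PiLp.inner_apply, this, Finset.sum_sub_distrib, ← Finset.mul_sum,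
      sum_eq_one_of_mem_weightSet hq, sum_eq_one_of_mem_weightSet hp.1, sub_self]
  have hangle' : ⟪w - η • h - p, q - p⟫ ≤ 0 := by
    have : w - η • h - p = (w - η • g - p) - η • (h - g) := by module
    rw [this, inner_sub_left, real_inner_smul_left, hshift]
    linarith
  have h1 : ‖w - η • h - q‖ ^ 2
      = ‖w - η • h - p‖ ^ 2 - 2 * ⟪w - η • h - p, q - p⟫ + ‖p - q‖ ^ 2 := by
    rw [norm_sub_rev p q, ← norm_sub_sq_real, sub_sub_sub_cancel_right]
  have h2 : ‖w - η • h - q‖ ^ 2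
      = ‖w - q‖ ^ 2 - 2 * η * ⟪h, w - q⟫ + η ^ 2 * ‖h‖ ^ 2 := by
    rw [sub_right_comm, norm_sub_sq_real, real_inner_smul_right, norm_smul, mul_pow,
      Real.norm_eq_abs, sq_abs, real_inner_comm]
    ring
  nlinarith [sq_nonneg ‖w - η • h - p‖]

/-- The uniform probability weights on `G`. -/
noncomputable def uniformWeights {N : ℕ} (G : Finset (Fin N)) : EuclideanSpace ℝ (Fin N) :=
  WithLp.toLp 2 fun i => if i ∈ G then (G.card : ℝ)⁻¹ else 0

theorem uniformWeights_mem_weightSet {N : ℕ} {G : Finset (Fin N)} {ε : ℝ} (hN : 0 < N)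
    (hε : ε < 1) (hG : (1 - ε) * N ≤ G.card) : uniformWeights G ∈ weightSet N ε := by
  have hpos : 0 < (1 - ε) * (N : ℝ) := mul_pos (by linarith) (by exact_mod_cast hN)
  have hcard : (0 : ℝ) < G.card := hpos.trans_le hG
  have h0 : ∀ i, 0 ≤ uniformWeights G i := fun i => by
    simp only [uniformWeights]
    split_ifs <;> positivity
  refine ⟨?_, fun i => ⟨h0 i, ?_⟩⟩
  · rw [Finset.sum_congr rfl fun i _ => abs_of_nonneg (h0 i)]
    simp [uniformWeights, hcard.ne']
  · simp only [uniformWeights]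
    split_ifs
    · rw [← one_div]
      exact one_div_le_one_div_of_le hpos hG
    · positivity

/-! ### Descent towards the good weights -/

/-- The gradient of `F(·, u)` at `w`, translated by a constant vector so that its entries are the
squared deviations of the points from `μ_w` in direction `u`. -/
noncomputable def centredGradient {N d : ℕ} (X : Fin N → EuclideanSpace ℝ (Fin d))
    (w : EuclideanSpace ℝ (Fin N)) (u : EuclideanSpace ℝ (Fin d)) : EuclideanSpace ℝ (Fin N) :=
  WithLp.toLp 2 fun i => ⟪X i - weightedMean X w, u⟫ ^ 2

theorem centredGradient_apply_eq {N d : ℕ} (X : Fin N → EuclideanSpace ℝ (Fin d))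
    (w : EuclideanSpace ℝ (Fin N)) (u : EuclideanSpace ℝ (Fin d)) (i : Fin N) :
    centredGradient X w u i
      = gradient (fun x => quadForm X x u) w i + ⟪weightedMean X w, u⟫ ^ 2 := by
  rw [gradient_quadForm]
  simp only [centredGradient, inner_sub_left]
  ring

theorem inner_centredGradient_sub {N d : ℕ} (X : Fin N → EuclideanSpace ℝ (Fin d))
    {w v : EuclideanSpace ℝ (Fin N)} (hw : ∑ i, w i = 1) (u : EuclideanSpace ℝ (Fin d)) :
    ⟪centredGradient X w u, w - v⟫
      = quadForm X w u - ∑ i, v i * ⟪X i - weightedMean X w, u⟫ ^ 2 := by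
  rw [quadForm_eq_sum_centred X hw, inner_sub_right]
  simp [PiLp.inner_apply, centredGradient]

theorem norm_centredGradient_sq_le {N d : ℕ} (X : Fin N → EuclideanSpace ℝ (Fin d))
    {w : EuclideanSpace ℝ (Fin N)} (hw0 : ∀ i, 0 ≤ w i) (hw : ∑ i, w i = 1)
    {u a : EuclideanSpace ℝ (Fin d)} (hu : ‖u‖ = 1) {R : ℝ} (hR : ∀ i, ‖X i - a‖ ≤ R) :
    ‖centredGradient X w u‖ ^ 2 ≤ N * (2 * R) ^ 4 := by
  have hmean : ‖weightedMean X w - a‖ ≤ R := by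
    have h : weightedMean X w - a = ∑ i, w i • (X i - a) := by
      simp only [weightedMean, smul_sub, Finset.sum_sub_distrib, ← Finset.sum_smul, hw, one_smul]
    rw [h]
    calc ‖∑ i, w i • (X i - a)‖ ≤ ∑ i, w i * R := norm_sum_le_of_le _ fun i _ => by
          rw [norm_smul, Real.norm_of_nonneg (hw0 i)]
          exact mul_le_mul_of_nonneg_left (hR i) (hw0 i)
      _ = R := by rw [← Finset.sum_mul, hw, one_mul]
  have hi : ∀ i, |⟪X i - weightedMean X w, u⟫| ≤ 2 * R := fun i => by
    refine (abs_real_inner_le_norm _ _).trans ?_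
    rw [hu, mul_one, ← sub_sub_sub_cancel_right _ _ a]
    exact (norm_sub_le _ _).trans (by linarith [hR i])
  rw [EuclideanSpace.real_norm_sq_eq]
  calc ∑ i, centredGradient X w u i ^ 2 ≤ ∑ _i : Fin N, (2 * R) ^ 4 :=
        Finset.sum_le_sum fun i _ => by
          simp only [centredGradient]
          rw [← pow_mul, ← Even.pow_abs (by decide : Even (2 * 2))]
          exact pow_le_pow_left₀ (abs_nonneg _) (hi i) 4
    _ = N * (2 * R) ^ 4 := by simp

/-- The good samples, weighted uniformly, have second moment at most `1 + c ε log(1/ε)` about `μ` in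
every direction. -/
theorem sum_uniformWeights_le {N d : ℕ} {X : Fin N → EuclideanSpace ℝ (Fin d)}
    {G : Finset (Fin N)} {μ : EuclideanSpace ℝ (Fin d)} {ε c : ℝ} (h : GoodMoments X G μ ε c)
    (hmem : uniformWeights G ∈ weightSet N (2 * ε)) {u : EuclideanSpace ℝ (Fin d)}
    (hu : ‖u‖ = 1) :
    ∑ i, uniformWeights G i * ⟪X i - μ, u⟫ ^ 2 ≤ 1 + c * (ε * Real.log (1 / ε)) := by
  have h1 := (dotProduct_mulVec_le_spectralNorm₂ _ hu).trans (h _ hmem)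
  have h2 : u.ofLp ⬝ᵥ u.ofLp = 1 := by
    have := EuclideanSpace.inner_eq_star_dotProduct u u
    rw [real_inner_self_eq_norm_sq, hu] at this
    simpa using this.symm
  rw [Matrix.sub_mulVec, dotProduct_sub, dotProduct_sum_smul_outerSq_mulVec, Matrix.one_mulVec,
    h2] at h1
  have h3 : ∑ i ∈ G, uniformWeights G i * ⟪X i - μ, u⟫ ^ 2
      = ∑ i, uniformWeights G i * ⟪X i - μ, u⟫ ^ 2 :=
    Finset.sum_subset (Finset.subset_univ G) fun i _ hi => by simp [uniformWeights, hi]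
  linarith

/-- The numerical core of `half_le_inner_centredGradient`, with `l = log(1/ε)`. The number `δ` is the
excess of `‖Σ_w‖₂` over `1`, and `t`, `b` are the components in direction `u` of `μ_v - μ`, for `v`
uniform on the good samples, and of `μ - μ_w`. -/
theorem half_le_of_excess {c₁ c₂ ε l δ t b : ℝ} (hc₁ : 0 < c₁) (hc₂ : 0 < c₂) (hε : 0 < ε)
    (hε' : ε ≤ 1 / (64 * (1 + c₂) ^ 2)) (hl : 1 ≤ l) (hl' : ε * l ≤ 1)
    (hδ : (64 * (1 + c₁) * (1 + c₂)) ^ 2 * (ε * l) ≤ δ) (ht : t ^ 2 ≤ 1 + c₁ * (ε * l))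
    (hb : |b| ≤ c₂ * (√(ε * δ) + ε * √l)) :
    δ / 2 ≤ (1 - ε) * (1 + δ) - (1 + c₁ * (ε * l) + 2 * t * b + b ^ 2) := by
  -- `δ ≥ s² ε l` makes `ε`, `ε l`, `√(ε δ)` and `ε √l` all small multiples of `δ`.
  set s := 64 * (1 + c₁) * (1 + c₂) with hs
  have hs64 : 64 * (1 + c₁) ≤ s := by rw [hs]; nlinarith
  have hs1 : 1 ≤ s := by linarith
  have hLpos : 0 < ε * l := by positivity
  have hεL : ε ≤ ε * l := le_mul_of_one_le_right hε.le hl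
  have hLs : ε * l ≤ δ / s ^ 2 := by rw [le_div_iff₀ (by positivity)]; linarith
  have hδpos : 0 < δ := lt_of_lt_of_le (by positivity) hδ
  have hLδ : ε * l ≤ δ := hLs.trans (div_le_self hδpos.le (one_le_pow₀ hs1))
  have hr1 : √(ε * δ) ≤ δ / s := by
    rw [Real.sqrt_le_left (by positivity), div_pow]
    calc ε * δ ≤ δ / s ^ 2 * δ := mul_le_mul_of_nonneg_right (hεL.trans hLs) hδpos.le
      _ = δ ^ 2 / s ^ 2 := by ring
  have hr2 : ε * √l ≤ √(ε * δ) := by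
    refine Real.le_sqrt_of_sq_le ?_
    rw [mul_pow, Real.sq_sqrt (by linarith)]
    nlinarith
  have hB : |b| ≤ 2 * c₂ * √(ε * δ) := hb.trans (by nlinarith)
  have hB1 : |b| ≤ δ / (32 * (1 + c₁)) := by
    refine hB.trans ((mul_le_mul_of_nonneg_left hr1 (by positivity)).trans ?_)
    rw [hs, mul_div_assoc', div_le_div_iff₀ (by positivity) (by positivity)]
    nlinarith [mul_pos (mul_pos hδpos hc₂) (show 0 < 1 + c₁ by linarith),
      mul_pos hδpos (show 0 < 1 + c₁ by linarith)]
  have hc2ε : c₂ ^ 2 * ε ≤ 1 / 64 := by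
    rw [le_div_iff₀ (by positivity)] at hε'
    nlinarith [mul_pos hε hc₂]
  have hB2 : b ^ 2 ≤ δ / 16 := by
    calc b ^ 2 = |b| ^ 2 := (sq_abs b).symm
      _ ≤ (2 * c₂ * √(ε * δ)) ^ 2 := pow_le_pow_left₀ (abs_nonneg _) hB 2
      _ = 4 * (c₂ ^ 2 * ε) * δ := by
        rw [mul_pow, Real.sq_sqrt (by positivity)]
        ring
      _ ≤ δ / 16 := by nlinarith
  -- A bound of order one on `t` suffices, since `b` is already small compared with `δ`.
  have ht' : |t| ≤ 1 + c₁ := by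
    refine abs_le_of_sq_le_sq (ht.trans ?_) (by linarith)
    nlinarith
  have htb : t * b ≤ δ / 32 := by
    calc t * b ≤ |t * b| := le_abs_self _
      _ = |t| * |b| := abs_mul t b
      _ ≤ (1 + c₁) * (δ / (32 * (1 + c₁))) :=
        mul_le_mul ht' hB1 (abs_nonneg _) (by linarith)
      _ = δ / 32 := by field_simp
  have hcL : (1 + c₁) * (ε * l) ≤ δ / 64 := by
    have h1 : s ≤ s ^ 2 := by nlinarith
    have h2 : 64 * (1 + c₁) * (ε * l) ≤ s ^ 2 * (ε * l) :=
      mul_le_mul_of_nonneg_right (hs64.trans h1) hLpos.le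
    linarith
  have hε64 : ε ≤ 1 / 64 := hε'.trans (one_div_le_one_div_of_le (by norm_num) (by nlinarith))
  nlinarith

/-- Above the threshold `δ₀`, the (translated) gradient correlates with the direction from the
uniform weights on the good samples to the current weights. The reason is the identity
`⟨∇_w F(w, u), w - v⟩ = F(w, u) - ∑ i, v_i ⟨X_i - μ_w, u⟩²`: the first term is close to `‖Σ_w‖₂`, and
for `v` uniform on the good samples the second is `1` up to the distance from `μ_w` to `μ`, which
`‖Σ_w‖₂` itself controls. -/
theorem half_le_inner_centredGradient {N d : ℕ} {X : Fin N → EuclideanSpace ℝ (Fin d)}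
    {G : Finset (Fin N)} {μ u : EuclideanSpace ℝ (Fin d)} {w : EuclideanSpace ℝ (Fin N)}
    {c₁ c₂ ε δ₀ : ℝ} (hc₁ : 0 < c₁) (hc₂ : 0 < c₂) (hε : 0 < ε)
    (hε' : ε ≤ 1 / (64 * (1 + c₂) ^ 2)) (hl : 1 ≤ Real.log (1 / ε))
    (hl' : ε * Real.log (1 / ε) ≤ 1)
    (hδ₀ : δ₀ = (64 * (1 + c₁) * (1 + c₂)) ^ 2 * (ε * Real.log (1 / ε)))
    (hgood : GoodMoments X G μ ε c₁) (hcert : CovCertifiesMean X μ ε c₂)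
    (hG : uniformWeights G ∈ weightSet N (2 * ε)) (hw : w ∈ weightSet N (2 * ε)) (hu : ‖u‖ = 1)
    (hmax : ∀ v : EuclideanSpace ℝ (Fin d), ‖v‖ = 1 →
      (1 - ε) * quadForm X w v ≤ quadForm X w u)
    (hbad : 1 + δ₀ < spectralNorm₂ (weightedCov X w)) :
    δ₀ / 2 ≤ ⟪centredGradient X w u, w - uniformWeights G⟫ := by
  have hw1 := sum_eq_one_of_mem_weightSet hw
  have hw0 := fun i => (hw.2 i).1
  have hG1 := sum_eq_one_of_mem_weightSet hG
  have hε1 : ε < 1 := by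
    refine hε'.trans_lt ((div_lt_one (by positivity)).2 ?_)
    nlinarith
  set δ := spectralNorm₂ (weightedCov X w) - 1 with hδ
  have hδ₀δ : δ₀ ≤ δ := by linarith
  have hδ₀pos : 0 ≤ δ₀ := by rw [hδ₀]; positivity
  have hF : (1 - ε) * (1 + δ) ≤ quadForm X w u := by
    rw [← le_div_iff₀' (by linarith), hδ, add_sub_cancel]
    refine spectralNorm₂_weightedCov_le X hw0 hw1
      (div_nonneg (quadForm_nonneg X hw0 hw1 u) (by linarith)) fun v hv => ?_
    rw [le_div_iff₀' (by linarith)]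
    exact hmax v hv
  set t := ⟪weightedMean X (uniformWeights G) - μ, u⟫ with ht
  set b := ⟪μ - weightedMean X w, u⟫ with hb
  have hmom := sum_uniformWeights_le hgood hG hu
  have hμ := sum_mul_inner_sub_sq X hG1 μ u
  have hμw := sum_mul_inner_sub_sq X hG1 (weightedMean X w) u
  have htb : ⟪weightedMean X (uniformWeights G) - weightedMean X w, u⟫ = t + b := by
    rw [ht, hb, ← inner_add_left, sub_add_sub_cancel]
  have hq := quadForm_nonneg X (fun i => (hG.2 i).1) hG1 u
  -- The variance of the good samples in direction `u` is nonnegative.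
  have htsq : t ^ 2 ≤ 1 + c₁ * (ε * Real.log (1 / ε)) := by linarith
  have hbabs : |b| ≤ c₂ * (√(ε * δ) + ε * √(Real.log (1 / ε))) := by
    refine ((abs_real_inner_le_norm _ _).trans ?_).trans
      (hcert w hw δ (hδ₀pos.trans hδ₀δ) (by linarith))
    rw [hu, mul_one]
  have hcore := half_le_of_excess hc₁ hc₂ hε hε' hl hl' (hδ₀ ▸ hδ₀δ) htsq hbabs
  rw [inner_centredGradient_sub X hw1, hμw, htb]
  nlinarith

/-- A run all of whose iterates lie above the threshold would approach the uniform weights on the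
good samples by a fixed amount in every step, hence is short. -/
theorem IsPGDRun.exists_spectralNorm₂_le {N d T : ℕ} {X : Fin N → EuclideanSpace ℝ (Fin d)}
    {G : Finset (Fin N)} {μ a : EuclideanSpace ℝ (Fin d)} {w : ℕ → EuclideanSpace ℝ (Fin N)}
    {u : ℕ → EuclideanSpace ℝ (Fin d)} {c₁ c₂ ε δ₀ R H : ℝ} (hc₁ : 0 < c₁) (hc₂ : 0 < c₂)
    (hε : 0 < ε) (hε' : ε ≤ 1 / (64 * (1 + c₂) ^ 2)) (hl : 1 ≤ Real.log (1 / ε))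
    (hl' : ε * Real.log (1 / ε) ≤ 1)
    (hδ₀ : δ₀ = (64 * (1 + c₁) * (1 + c₂)) ^ 2 * (ε * Real.log (1 / ε)))
    (hgood : GoodMoments X G μ ε c₁) (hcert : CovCertifiesMean X μ ε c₂)
    (hG : uniformWeights G ∈ weightSet N (2 * ε)) (hR : ∀ i, ‖X i - a‖ ≤ R)
    (hH : H = N * (2 * R) ^ 4) (hHpos : 0 < H) (hT : 16 * H / δ₀ ^ 2 < T)
    (hrun : IsPGDRun X ε (δ₀ / (2 * H)) T w u) :
    ∃ τ < T, spectralNorm₂ (weightedCov X (w τ)) ≤ 1 + δ₀ := by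
  by_contra! hbad
  have hmem : ∀ τ ≤ T, w τ ∈ weightSet N (2 * ε)
    | 0, _ => hrun.init
    | τ + 1, hτ => (hrun.step τ hτ).1
  have hδpos : 0 < δ₀ := by rw [hδ₀]; positivity
  have hstep : ∀ τ < T, ‖w (τ + 1) - uniformWeights G‖ ^ 2
      ≤ ‖w τ - uniformWeights G‖ ^ 2 - δ₀ ^ 2 / (4 * H) := by
    intro τ hτ
    have hwτ := hmem τ hτ.le
    have h1 := (hrun.step τ hτ).norm_sub_sq_le hG (centredGradient_apply_eq X (w τ) (u τ))
    have h2 := half_le_inner_centredGradient hc₁ hc₂ hε hε' hl hl' hδ₀ hgood hcert hG hwτ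
      (hrun.unit τ hτ) (hrun.approx_max τ hτ) (hbad τ hτ)
    have h3 := norm_centredGradient_sq_le X (fun i => (hwτ.2 i).1)
      (sum_eq_one_of_mem_weightSet hwτ) (hrun.unit τ hτ) hR
    rw [← hH] at h3
    have h4 := mul_le_mul_of_nonneg_left h2 (show 0 ≤ 2 * (δ₀ / (2 * H)) by positivity)
    have h5 := mul_le_mul_of_nonneg_left h3 (sq_nonneg (δ₀ / (2 * H)))
    -- The step size `δ₀ / (2 H)` maximizes the guaranteed decrease `η δ₀ - η² H`.
    have h6 : 2 * (δ₀ / (2 * H)) * (δ₀ / 2) - (δ₀ / (2 * H)) ^ 2 * H = δ₀ ^ 2 / (4 * H) := by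
      field_simp
      ring
    linarith
  have hsum : ∀ τ ≤ T, ‖w τ - uniformWeights G‖ ^ 2
      ≤ ‖w 0 - uniformWeights G‖ ^ 2 - τ * (δ₀ ^ 2 / (4 * H)) := by
    intro τ
    induction τ with
    | zero => simp
    | succ τ ih =>
      intro hτ
      have := hstep τ hτ
      have := ih (by lia)
      push_cast
      linarith
  have h0 : ‖w 0 - uniformWeights G‖ ≤ 2 := by
    refine (norm_sub_le _ _).trans ?_
    linarith [norm_le_one_of_mem_weightSet hrun.init, norm_le_one_of_mem_weightSet hG]
  have h1 := hsum T le_rfl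
  have h2 : 4 < T * (δ₀ ^ 2 / (4 * H)) := by
    rw [div_lt_iff₀ (by positivity)] at hT
    rw [mul_div_assoc', lt_div_iff₀ (by positivity)]
    linarith
  nlinarith [norm_nonneg (w 0 - uniformWeights G), sq_nonneg ‖w T - uniformWeights G‖]

theorem theorem4p1 (c₁ c₂ c₃ : ℝ) (hc₁ : 0 < c₁) (hc₂ : 0 < c₂) (hc₃ : 0 < c₃) :
    ∃ (ε₀ C K : ℝ) (k : ℕ), 0 < ε₀ ∧ ε₀ < 1 / 2 ∧ 0 < C ∧ 0 < K ∧
      ∀ (d N : ℕ) (ε : ℝ), 1 ≤ d → 0 < ε → ε < ε₀ → (d : ℝ) / ε ^ 2 ≤ N →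
        ∃ η : ℝ, 0 < η ∧
          ∀ (X : Fin N → EuclideanSpace ℝ (Fin d)) (μ : EuclideanSpace ℝ (Fin d))
            (G : Finset (Fin N)),
            ((Gᶜ.card : ℕ) : ℝ) ≤ ε * N →
            GoodMoments X G μ ε c₁ →
            CovCertifiesMean X μ ε c₂ →
            (∃ a : EuclideanSpace ℝ (Fin d), ∀ i, ‖X i - a‖ ≤ c₃ * √(d * Real.log (N * d))) →
            ∀ (T : ℕ), K * ((N : ℝ) ^ 2 * (d : ℝ) ^ 4 * Real.log (N * d) ^ k) ≤ T →
              ∀ (w : ℕ → EuclideanSpace ℝ (Fin N)) (u : ℕ → EuclideanSpace ℝ (Fin d)),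
                IsPGDRun X ε η T w u →
                ∀ x : EuclideanSpace ℝ (Fin N), IsPGDOutput X T w x →
                  ‖weightedMean X x - μ‖ ≤ C * (ε * √(Real.log (1 / ε))) := by
  set s := 64 * (1 + c₁) * (1 + c₂) with hs
  have hs1 : 1 ≤ s := by
    rw [hs]
    nlinarith [mul_pos hc₁ hc₂]
  have hε₀ : 1 / (64 * (1 + c₂) ^ 2) ≤ 1 / 64 :=
    one_div_le_one_div_of_le (by norm_num) (by nlinarith)
  refine ⟨1 / (64 * (1 + c₂) ^ 2), c₂ * (s + 1), 257 * c₃ ^ 4, 2, by positivity, by linarith,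
    by positivity, by positivity, ?_⟩
  intro d N ε hd hε hεlt hN
  have hε64 : ε < 1 / 64 := hεlt.trans_le hε₀
  have hd1 : (1 : ℝ) ≤ d := by exact_mod_cast hd
  have hεN : 1 / ε ^ 2 ≤ N := (div_le_div_of_nonneg_right hd1 (sq_nonneg ε)).trans hN
  have hN64 : (64 : ℝ) ≤ N := by
    refine le_trans ?_ hεN
    rw [le_div_iff₀ (by positivity)]
    nlinarith
  have hl : 1 ≤ Real.log (1 / ε) := by
    rw [Real.le_log_iff_exp_le (by positivity)]
    refine Real.exp_one_lt_three.le.trans ?_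
    rw [le_div_iff₀ hε]
    linarith
  have hl' : ε * Real.log (1 / ε) ≤ 1 := by
    have := Real.log_le_self (show 0 ≤ 1 / ε by positivity)
    calc ε * Real.log (1 / ε) ≤ ε * (1 / ε) := mul_le_mul_of_nonneg_left this hε.le
      _ = 1 := mul_one_div_cancel hε.ne'
  have hlogpos : 0 < Real.log (N * d) := Real.log_pos (by nlinarith)
  set δ₀ := s ^ 2 * (ε * Real.log (1 / ε)) with hδ₀
  set R := c₃ * √(d * Real.log (N * d)) with hR
  set H := N * (2 * R) ^ 4 with hH
  have hHeq : H = 16 * c₃ ^ 4 * (N * d ^ 2 * Real.log (N * d) ^ 2) := by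
    have : √(d * Real.log (N * d)) ^ 4 = (d * Real.log (N * d)) ^ 2 := by
      rw [show 4 = 2 * 2 from rfl, pow_mul, Real.sq_sqrt (by positivity)]
    rw [hH, hR, mul_pow, mul_pow, this]
    ring
  have hHpos : 0 < H := by
    rw [hHeq]
    positivity
  have hεδ : ε ≤ δ₀ := by
    have h1 : ε ≤ ε * Real.log (1 / ε) := le_mul_of_one_le_right hε.le hl
    exact h1.trans (le_mul_of_one_le_left (by positivity) (one_le_pow₀ hs1))
  have hδpos : 0 < δ₀ := hε.trans_le hεδ
  refine ⟨δ₀ / (2 * H), by positivity, ?_⟩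
  rintro X μ G hGc hgood hcert ⟨a, ha⟩ T hT w u hrun x ⟨τ', hτ', rfl, hmin⟩
  have hG : uniformWeights G ∈ weightSet N (2 * ε) := by
    refine uniformWeights_mem_weightSet (by exact_mod_cast (by linarith : (0 : ℝ) < N))
      (by linarith) ?_
    have hcard : (G.card : ℝ) + Gᶜ.card = N := by
      exact_mod_cast (Finset.card_add_card_compl G).trans (Fintype.card_fin N)
    nlinarith
  -- The constant `257` instead of `256` makes the bound strict.
  have hT' : 16 * H / δ₀ ^ 2 < T := by
    have h1 : 16 * H / δ₀ ^ 2 ≤ 16 * H * N := by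
      rw [div_eq_mul_one_div]
      refine mul_le_mul_of_nonneg_left (le_trans ?_ hεN) (by positivity)
      exact one_div_le_one_div_of_le (by positivity) (pow_le_pow_left₀ hε.le hεδ 2)
    have h2 : 16 * H * N ≤ 256 * c₃ ^ 4 * (N ^ 2 * d ^ 4 * Real.log (N * d) ^ 2) := by
      rw [hHeq]
      have : (d : ℝ) ^ 2 ≤ d ^ 4 := pow_le_pow_right₀ hd1 (by norm_num)
      calc 16 * (16 * c₃ ^ 4 * (N * d ^ 2 * Real.log (N * d) ^ 2)) * N
          = 256 * c₃ ^ 4 * (N ^ 2 * d ^ 2 * Real.log (N * d) ^ 2) := by ring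
        _ ≤ _ := by gcongr
    have h3 : 0 < c₃ ^ 4 * (N ^ 2 * d ^ 4 * Real.log (N * d) ^ 2) := by positivity
    linarith
  obtain ⟨τ, hτ, hle⟩ := hrun.exists_spectralNorm₂_le hc₁ hc₂ hε hεlt.le hl hl' hδ₀ hgood hcert
    hG ha hH hHpos hT'
  have hwτ' : w τ' ∈ weightSet N (2 * ε) := by
    cases τ' with
    | zero => exact hrun.init
    | succ σ => exact (hrun.step σ (by lia)).1
  have hfin := hcert _ hwτ' δ₀ hδpos.le ((hmin τ hτ).trans hle)
  have hsqrt : √(ε * δ₀) = s * (ε * √(Real.log (1 / ε))) := by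
    rw [hδ₀, show ε * (s ^ 2 * (ε * Real.log (1 / ε))) = (s * ε) ^ 2 * Real.log (1 / ε) by ring,
      Real.sqrt_mul (sq_nonneg _), Real.sqrt_sq (by positivity)]
    ring
  rw [norm_sub_rev]
  refine hfin.trans (le_of_eq ?_)
  rw [hsqrt]
  ring
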